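/- Let $\mathcal H$ be a finite-dimensional complex Hilbert space, $H$ a Hermitian operator on $\mathcal H$ and $(L_\mu)_\mu$ a finite family of operators on $\mathcal H$. Let $$\hat{\mathcal L}[\rho]=-\mathrm i[H,\rho]+\sum_\mu\left(2L_\mu\rho L_\mu^\dagger-\{L_\mu^\dagger L_\mu,\rho\}\right)$$ be the corresponding Liouvillian on operators, and let $\hat{\mathcal L}^\dagger[\sigma]=\mathrm i[H,\sigma]+\sum_\mu(2L_\mu^\dagger\sigma L_\mu-\{L_\mu^\dagger L_\mu,\sigma\})$ be its adjoint for the Hilbert--Schmidt inner product $\langle\sigma,\rho\rangle=\mathrm{Tr}(\sigma^\dagger\rho)$. A steady state is a density operator $\rho_\infty$ (positive semidefinite, of trace one) with $\hat{\mathcal L}[\rho_\infty]=0$. For $\omega\in\mathbb R$, a strong dynamical symmetry of frequency $\omega$ is an operator $A$ (not necessarily unitary) with $[H,A]=\omega A$ and $[L_\mu,A]=[L_\mu^\dagger,A]=0$ for all $\mu$. Assume that an invertible steady state exists. Then: 1. A nonzero operator $\rho$ satisfies $\hat{\mathcal L}[\rho]=\lambda\rho$ for some $\lambda\in\mathrm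 i\mathbb R$ (zero included) if and only if $\rho=A^n\rho_\infty(A^\dagger)^m$ for some integers $n,m\ge 0$, some strong dynamical symmetry $A$ of some frequency $\omega\in\mathbb R$, and some steady state $\rho_\infty$ (not necessarily the invertible one). 2. If $A$ is a strong dynamical symmetry of frequency $\omega$, $\rho_\infty$ is a steady state and $\rho_{nm}=A^n\rho_\infty(A^\dagger)^m\neq0$, then $\rho_{nm}$ is an eigenvector of $\hat{\mathcal L}$ with eigenvalue $\lambda=-\mathrm i\omega(n-m)$. 3. A nonzero operator $\sigma$ satisfies $\hat{\mathcal L}^\dagger[\sigma]=\lambda\sigma$ for some $\lambda\in\mathrm i\mathbb R$ if and only if $\sigma=(A')^m(A'^\dagger)^n$ for some integers $n,m\ge0$ and some strong dynamical symmetry $A'$. If $A'$ is a strong dynamical symmetry of frequency $-\omega$ and $\sigma_{mn}=(A')^m(A'^\dagger)^n\ne0$, then $\hat{\mathcal L}^\dagger[\sigma_{mn}]=\mathrm i\omega(n-m)\sigma_{mn}$. 4. For every $\rho_{nm}\neq0$ as in 2 there is a strong dynamical symmetry $A'$ of frequency $-\omega$ such that $\sigma_{mn}=(A')^m(A'^\dagger)^n$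 (same $n,m$) is nonzero, hence a left eigenvector with $\hat{\mathcal L}^\dagger[\sigma_{mn}]=\mathrm i\omega(n-m)\sigma_{mn}=\lambda^*\sigma_{mn}$. Moreover, for every purely imaginary $\lambda$ and every basis $(\rho_i)$ of $\ker(\hat{\mathcal L}-\lambda)$ there are $\omega\in\mathbb R$ and integers $n,m\ge0$ with $\lambda=-\mathrm i\omega(n-m)$, and operators $\sigma_i$ with $\mathrm{Tr}(\sigma_i^\dagger\rho_j)=\delta_{ij}$ and $\hat{\mathcal L}^\dagger[\sigma_i]=\lambda^*\sigma_i$, such that for each $i$ we have $\rho_i=A_i^n\rho_{\infty,i}(A_i^\dagger)^m$ and $\sigma_i=(A_i')^m(A_i'^\dagger)^n$, where $A_i$ is a strong dynamical symmetry of frequency $\omega$, $A_i'$ is one of frequency $-\omega$, and $\rho_{\infty,i}$ is a steady state. -/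

import Mathlib

open scoped Matrix ComplexOrder

namespace Lindblad

variable {d ι : Type*} [Fintype d] [DecidableEq d] [Fintype ι]

/-- The Liouvillian with Hamiltonian `H` and jump operators `L μ`, acting on operators on the
Hilbert space `ℂ^d`:
`𝓛[ρ] = -i [H, ρ] + ∑ μ, (2 L_μ ρ L_μ† - {L_μ† L_μ, ρ})`. -/
noncomputable def liouvillian (H : Matrix d d ℂ) (L : ι → Matrix d d ℂ) :
    Module.End ℂ (Matrix d d ℂ) where
  toFun ρ := -Complex.I • (H * ρ - ρ * H) +
    ∑ μ, ((2 : ℂ) • (L μ * ρ * (L μ)ᴴ) - ((L μ)ᴴ * L μ * ρ + ρ * ((L μ)ᴴ * L μ)))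
  map_add' x y := by
    rw [add_add_add_comm, ← Finset.sum_add_distrib, ← smul_add]
    congr 1
    · congr 1
      noncomm_ring
    · refine Finset.sum_congr rfl fun μ _ => ?_
      simp only [mul_add, add_mul, smul_add]
      abel
  map_smul' c x := by
    simp only [RingHom.id_apply, Matrix.mul_smul, Matrix.smul_mul, ← smul_sub, ← smul_add,
      smul_comm (2 : ℂ) c, ← Finset.smul_sum, smul_comm (-Complex.I) c]

/-- The adjoint Liouvillian (generator of the Heisenberg evolution):
`𝓛†[σ] = i [H, σ] + ∑ μ, (2 L_μ† σ L_μ - {L_μ† L_μ, σ})`. It is the Hilbert-Schmidt adjoint of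
`liouvillian H L`, see `hsInner_adjointLiouvillian`. -/
noncomputable def adjointLiouvillian (H : Matrix d d ℂ) (L : ι → Matrix d d ℂ) :
    Module.End ℂ (Matrix d d ℂ) where
  toFun σ := Complex.I • (H * σ - σ * H) +
    ∑ μ, ((2 : ℂ) • ((L μ)ᴴ * σ * L μ) - ((L μ)ᴴ * L μ * σ + σ * ((L μ)ᴴ * L μ)))
  map_add' x y := by
    rw [add_add_add_comm, ← Finset.sum_add_distrib, ← smul_add]
    congr 1
    · congr 1
      noncomm_ring
    · refine Finset.sum_congr rfl fun μ _ => ?_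
      simp only [mul_add, add_mul, smul_add]
      abel
  map_smul' c x := by
    simp only [RingHom.id_apply, Matrix.mul_smul, Matrix.smul_mul, ← smul_sub, ← smul_add,
      smul_comm (2 : ℂ) c, ← Finset.smul_sum, smul_comm Complex.I c]

/-- The Hilbert-Schmidt inner product `Tr (σ† ρ)`. -/
def hsInner (σ ρ : Matrix d d ℂ) : ℂ := (σᴴ * ρ).trace

/-- `adjointLiouvillian` is the adjoint of `liouvillian` for the Hilbert-Schmidt inner product. -/
theorem hsInner_adjointLiouvillian (H : Matrix d d ℂ) (hH : H.IsHermitian)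
    (L : ι → Matrix d d ℂ) (σ ρ : Matrix d d ℂ) :
    hsInner (adjointLiouvillian H L σ) ρ = hsInner σ (liouvillian H L ρ) := by
  have h1 : (σᴴ * H * ρ).trace = (σᴴ * (H * ρ)).trace := by rw [Matrix.mul_assoc]
  have h2 : (H * σᴴ * ρ).trace = (σᴴ * (ρ * H)).trace := by
    rw [Matrix.mul_assoc, Matrix.trace_mul_comm, Matrix.mul_assoc]
  simp only [hsInner, adjointLiouvillian, liouvillian, LinearMap.coe_mk, AddHom.coe_mk,
    Matrix.conjTranspose_add, Matrix.conjTranspose_sub, Matrix.conjTranspose_smul,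
    Matrix.conjTranspose_mul, Matrix.conjTranspose_sum, Matrix.conjTranspose_conjTranspose,
    hH.eq, add_mul, mul_add, Finset.sum_mul, Finset.mul_sum, Matrix.trace_add, Matrix.trace_sum]
  congr 1
  · simp only [Matrix.smul_mul, Matrix.mul_smul, sub_mul, mul_sub, Matrix.trace_smul,
      Matrix.trace_sub, h1, h2]
    simp
  · refine Finset.sum_congr rfl fun μ _ => ?_
    have h3 : ((L μ)ᴴ * (σᴴ * L μ) * ρ).trace = (σᴴ * (L μ * ρ * (L μ)ᴴ)).trace := by
      rw [Matrix.mul_assoc, Matrix.trace_mul_comm]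
      simp only [Matrix.mul_assoc]
    have h4 : ((L μ)ᴴ * L μ * σᴴ * ρ).trace = (σᴴ * (ρ * ((L μ)ᴴ * L μ))).trace := by
      rw [Matrix.mul_assoc, Matrix.trace_mul_comm, Matrix.mul_assoc]
    simp only [Matrix.smul_mul, Matrix.mul_smul, sub_mul, mul_sub, add_mul, mul_add,
      Matrix.trace_smul, Matrix.trace_sub, Matrix.trace_add, h3, h4]
    simp [Matrix.mul_assoc, add_comm]

/-- A non-equilibrium steady state: a density operator annihilated by the Liouvillian. -/
structure IsSteadyState (H : Matrix d d ℂ) (L : ι → Matrix d d ℂ) (ρ : Matrix d d ℂ) : Prop where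
  posSemidef : ρ.PosSemidef
  trace_eq_one : ρ.trace = 1
  stationary : liouvillian H L ρ = 0

/-- `A` is a strong dynamical symmetry of frequency `ω`:
`[H, A] = ω A` and `[L_μ, A] = [L_μ†, A] = 0` for all `μ`. -/
structure IsStrongDynamicalSymmetry (H : Matrix d d ℂ) (L : ι → Matrix d d ℂ) (ω : ℝ)
    (A : Matrix d d ℂ) : Prop where
  hamiltonian : H * A - A * H = (ω : ℂ) • A
  jump : ∀ μ, L μ * A - A * L μ = 0
  jump_adjoint : ∀ μ, (L μ)ᴴ * A - A * (L μ)ᴴ = 0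

end Lindblad

namespace Lindblad

open Matrix

variable {d ι : Type*} [Fintype d] [DecidableEq d] [Fintype ι]
  {H : Matrix d d ℂ} {L : ι → Matrix d d ℂ}

/-! Everything rests on the Heisenberg side. If `𝓛† X = i l X` with `l` real, the dissipation
identity reduces to `𝓛†(X† X) = 2 ∑ [L_μ, X]† [L_μ, X]`. Its trace against a steady state is zero,
and an invertible one forces every `[L_μ, X]` to vanish. The same argument for `X†` gives `[L_μ†, X]
= 0`; the dissipator then drops out and leaves `[H, X] = l X`. So left eigenvectors are exactly the
strong dynamical symmetries (`adjointLiouvillian_eq_iff`).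

Right eigenvectors follow by counting dimensions: `A ↦ A ρ₀` embeds the left eigenspace for `-i l`
into the right one for `i l`, and since left and right eigenspaces for the same eigenvalue have
equal dimension, it is onto (`exists_eq_mul_steadyState`). Hence `n = 1`, `m = 0` and the single
steady state `ρ₀` always suffice. Conversely, symmetries are closed under products and adjoints, and
`liouvillian_mul_mul` gives the eigenvalues of `A^n ρ∞ (A†)^m`. Dual bases exist because `Y` pairs
nontrivially with `Y† ρ₀` (`exists_trace_mul_eq`). -/

theorem liouvillian_apply (H : Matrix d d ℂ) (L : ι → Matrix d d ℂ) (ρ : Matrix d d ℂ) :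
    liouvillian H L ρ = -Complex.I • (H * ρ - ρ * H) +
      ∑ μ, ((2 : ℂ) • (L μ * ρ * (L μ)ᴴ) - ((L μ)ᴴ * L μ * ρ + ρ * ((L μ)ᴴ * L μ))) := rfl

theorem adjointLiouvillian_apply (H : Matrix d d ℂ) (L : ι → Matrix d d ℂ) (σ : Matrix d d ℂ) :
    adjointLiouvillian H L σ = Complex.I • (H * σ - σ * H) +
      ∑ μ, ((2 : ℂ) • ((L μ)ᴴ * σ * L μ) - ((L μ)ᴴ * L μ * σ + σ * ((L μ)ᴴ * L μ))) := rfl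

theorem adjointLiouvillian_conjTranspose (hH : H.IsHermitian) (σ : Matrix d d ℂ) :
    adjointLiouvillian H L σᴴ = (adjointLiouvillian H L σ)ᴴ := by
  simp only [adjointLiouvillian_apply, conjTranspose_add, conjTranspose_sub, conjTranspose_smul,
    conjTranspose_mul, conjTranspose_sum, conjTranspose_conjTranspose, hH.eq]
  congr 1
  · rw [← neg_sub (H * σᴴ), smul_neg]
    simp
  · refine Finset.sum_congr rfl fun μ _ => ?_
    simp [mul_assoc, add_comm]

/-- `adjointLiouvillian` is also the transpose of `liouvillian` for the bilinear trace pairing. -/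
theorem trace_adjointLiouvillian_mul (hH : H.IsHermitian) (σ ρ : Matrix d d ℂ) :
    (adjointLiouvillian H L σ * ρ).trace = (σ * liouvillian H L ρ).trace := by
  have h := hsInner_adjointLiouvillian H hH L σᴴ ρ
  rwa [hsInner, hsInner, adjointLiouvillian_conjTranspose hH, conjTranspose_conjTranspose,
    conjTranspose_conjTranspose] at h

/-- The dissipation identity (carré du champ) of the Heisenberg generator. -/
theorem adjointLiouvillian_conjTranspose_mul_self (hH : H.IsHermitian) (X : Matrix d d ℂ) :
    adjointLiouvillian H L (Xᴴ * X) =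
      (adjointLiouvillian H L X)ᴴ * X + Xᴴ * adjointLiouvillian H L X +
        (2 : ℂ) • ∑ μ, (L μ * X - X * L μ)ᴴ * (L μ * X - X * L μ) := by
  rw [← adjointLiouvillian_conjTranspose hH]
  simp only [adjointLiouvillian_apply, add_mul, mul_add, Finset.sum_mul, Finset.mul_sum,
    Finset.smul_sum]
  have e : ∀ a b c e f : Matrix d d ℂ, a + b + (c + e) + f = (a + c) + (b + e + f) := by
    intros; abel
  rw [e, ← Finset.sum_add_distrib, ← Finset.sum_add_distrib]
  congr 1
  · simp only [Matrix.smul_mul, Matrix.mul_smul, ← smul_add]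
    congr 1
    noncomm_ring
  · refine Finset.sum_congr rfl fun μ _ => ?_
    simp only [conjTranspose_sub, conjTranspose_mul, two_smul]
    noncomm_ring

/-! ### Consequences of an invertible steady state for the dissipation. -/

section Faithful

variable {ρ₀ : Matrix d d ℂ}

omit [DecidableEq d] in
theorem trace_conjTranspose_mul_self_mul_nonneg (hρ : ρ₀.PosSemidef) (X : Matrix d d ℂ) :
    0 ≤ (Xᴴ * X * ρ₀).trace := by
  have h := (hρ.mul_mul_conjTranspose_same X).trace_nonneg
  rwa [Matrix.trace_mul_comm, ← Matrix.mul_assoc] at h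

open scoped MatrixOrder in
theorem eq_zero_of_trace_conjTranspose_mul_self_mul (hρ : ρ₀.PosSemidef) (hu : IsUnit ρ₀)
    {X : Matrix d d ℂ} (h : (Xᴴ * X * ρ₀).trace = 0) : X = 0 := by
  obtain ⟨B, rfl⟩ := CStarAlgebra.nonneg_iff_eq_star_mul_self.mp hρ.nonneg
  rw [star_eq_conjTranspose] at *
  have h0 : X * Bᴴ = 0 := by
    rw [← trace_conjTranspose_mul_self_eq_zero_iff, ← h, ← Matrix.mul_assoc,
      ← Matrix.mul_assoc, Matrix.trace_mul_comm _ B, conjTranspose_mul,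
      conjTranspose_conjTranspose]
    simp only [Matrix.mul_assoc]
  -- With `ρ₀ = B† B`, the vanishing of `X B†` gives `X ρ₀ = 0`, and `ρ₀` is invertible.
  refine hu.mul_left_eq_zero.mp ?_
  rw [← Matrix.mul_assoc, h0, Matrix.zero_mul]

/-- Eigenvectors of the Heisenberg generator with imaginary eigenvalue commute with the jump
operators, if there is a faithful steady state. -/
theorem jump_commute_of_adjointLiouvillian_eq (hH : H.IsHermitian) (hρ : IsSteadyState H L ρ₀)
    (hu : IsUnit ρ₀) {l : ℝ} {X : Matrix d d ℂ}
    (hX : adjointLiouvillian H L X = (Complex.I * l) • X) (μ : ι) :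
    L μ * X - X * L μ = 0 := by
  have h1 := adjointLiouvillian_conjTranspose_mul_self (L := L) hH X
  have h2 : (adjointLiouvillian H L (Xᴴ * X) * ρ₀).trace = 0 := by
    rw [trace_adjointLiouvillian_mul hH, hρ.stationary, Matrix.mul_zero, trace_zero]
  -- An imaginary eigenvalue cancels against its conjugate, so only the dissipation term survives.
  have h3 : (adjointLiouvillian H L X)ᴴ * X + Xᴴ * adjointLiouvillian H L X = 0 := by
    rw [hX]
    simp
  rw [h1, h3, zero_add, Matrix.smul_mul, trace_smul, smul_eq_mul, Finset.sum_mul, trace_sum] at h2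
  have h4 := (mul_eq_zero.mp h2).resolve_left two_ne_zero
  rw [Finset.sum_eq_zero_iff_of_nonneg fun μ _ =>
    trace_conjTranspose_mul_self_mul_nonneg hρ.posSemidef _] at h4
  exact eq_zero_of_trace_conjTranspose_mul_self_mul hρ.posSemidef hu (h4 μ (Finset.mem_univ μ))

end Faithful

/-! ### Algebra of strong dynamical symmetries. -/

namespace IsStrongDynamicalSymmetry

variable {a b ω : ℝ} {A B X Y : Matrix d d ℂ}

omit [Fintype ι] in
theorem one : IsStrongDynamicalSymmetry H L 0 (1 : Matrix d d ℂ) :=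
  ⟨by simp, by simp, by simp⟩

omit [Fintype ι] in
theorem mul (hA : IsStrongDynamicalSymmetry H L a A) (hB : IsStrongDynamicalSymmetry H L b B) :
    IsStrongDynamicalSymmetry H L (a + b) (A * B) := by
  have key : ∀ M : Matrix d d ℂ,
      M * (A * B) - A * B * M = (M * A - A * M) * B + A * (M * B - B * M) := by
    intro M
    noncomm_ring
  refine ⟨?_, fun μ => ?_, fun μ => ?_⟩
  · rw [key, hA.hamiltonian, hB.hamiltonian]
    simp [add_smul]
  · rw [key, hA.jump, hB.jump]
    simp
  · rw [key, hA.jump_adjoint, hB.jump_adjoint]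
    simp

omit [Fintype ι] in
theorem pow (hA : IsStrongDynamicalSymmetry H L a A) (n : ℕ) :
    IsStrongDynamicalSymmetry H L (n * a) (A ^ n) := by
  induction n with
  | zero => simpa using one
  | succ n ih =>
    rw [pow_succ]
    convert ih.mul hA using 1
    push_cast
    ring

omit [DecidableEq d] [Fintype ι] in
theorem conjTranspose (hH : H.IsHermitian) (hA : IsStrongDynamicalSymmetry H L a A) :
    IsStrongDynamicalSymmetry H L (-a) Aᴴ := by
  refine ⟨?_, fun μ => ?_, fun μ => ?_⟩
  · have h := congrArg Matrix.conjTranspose hA.hamiltonian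
    simp only [conjTranspose_sub, conjTranspose_mul, hH.eq, conjTranspose_smul] at h
    rw [← neg_sub, h]
    simp
  · have h := congrArg Matrix.conjTranspose (hA.jump_adjoint μ)
    simp only [conjTranspose_sub, conjTranspose_mul, conjTranspose_conjTranspose,
      conjTranspose_zero] at h
    rw [← neg_sub, h, neg_zero]
  · have h := congrArg Matrix.conjTranspose (hA.jump μ)
    simp only [conjTranspose_sub, conjTranspose_mul, conjTranspose_zero] at h
    rw [← neg_sub, h, neg_zero]

theorem adjointLiouvillian_eq (hA : IsStrongDynamicalSymmetry H L a A) :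
    adjointLiouvillian H L A = (Complex.I * a) • A := by
  rw [adjointLiouvillian_apply, hA.hamiltonian, smul_smul, Finset.sum_eq_zero, add_zero]
  intro μ _
  have h1 : (L μ)ᴴ * L μ * A = (L μ)ᴴ * A * L μ := by
    rw [Matrix.mul_assoc, sub_eq_zero.mp (hA.jump μ), Matrix.mul_assoc]
  have h2 : A * ((L μ)ᴴ * L μ) = (L μ)ᴴ * A * L μ := by
    rw [← Matrix.mul_assoc, sub_eq_zero.mp (hA.jump_adjoint μ)]
  rw [h1, h2, two_smul, sub_self]

/-- Both factors commute with all `L_μ` and `L_μ†`, so they pull out of the dissipator; only the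
Hamiltonian commutator sees them, and it contributes the two frequencies. -/
theorem liouvillian_mul_mul (hX : IsStrongDynamicalSymmetry H L a X)
    (hY : IsStrongDynamicalSymmetry H L b Y) (ρ : Matrix d d ℂ) :
    liouvillian H L (X * ρ * Y) =
      X * liouvillian H L ρ * Y - (Complex.I * (a + b)) • (X * ρ * Y) := by
  have hHX : H * X = X * H + (a : ℂ) • X := by rw [← hX.hamiltonian]; abel
  have hYH : Y * H = H * Y - (b : ℂ) • Y := by rw [← hY.hamiltonian]; abel
  have hLX : ∀ μ, L μ * X = X * L μ := fun μ => sub_eq_zero.mp (hX.jump μ)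
  have hLX' : ∀ μ, (L μ)ᴴ * X = X * (L μ)ᴴ := fun μ => sub_eq_zero.mp (hX.jump_adjoint μ)
  have hLY : ∀ μ, L μ * Y = Y * L μ := fun μ => sub_eq_zero.mp (hY.jump μ)
  have hLY' : ∀ μ, (L μ)ᴴ * Y = Y * (L μ)ᴴ := fun μ => sub_eq_zero.mp (hY.jump_adjoint μ)
  have hham : H * (X * ρ * Y) - X * ρ * Y * H =
      X * (H * ρ - ρ * H) * Y + ((a : ℂ) + b) • (X * ρ * Y) := by
    calc H * (X * ρ * Y) - X * ρ * Y * H = (H * X) * ρ * Y - X * ρ * (Y * H) := by noncomm_ring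
      _ = _ := by
        rw [hHX, hYH]
        simp only [add_mul, mul_sub, sub_mul, Matrix.smul_mul, Matrix.mul_smul, add_smul,
          Matrix.mul_assoc]
        abel
  have hdis : ∀ μ, (2 : ℂ) • (L μ * (X * ρ * Y) * (L μ)ᴴ) -
      ((L μ)ᴴ * L μ * (X * ρ * Y) + X * ρ * Y * ((L μ)ᴴ * L μ)) =
      X * ((2 : ℂ) • (L μ * ρ * (L μ)ᴴ) -
        ((L μ)ᴴ * L μ * ρ + ρ * ((L μ)ᴴ * L μ))) * Y := by
    intro μ
    have h1 : L μ * (X * ρ * Y) * (L μ)ᴴ = X * (L μ * ρ * (L μ)ᴴ) * Y := by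
      calc L μ * (X * ρ * Y) * (L μ)ᴴ = (L μ * X) * ρ * (Y * (L μ)ᴴ) := by noncomm_ring
        _ = _ := by rw [hLX, ← hLY']; noncomm_ring
    have h2 : (L μ)ᴴ * L μ * (X * ρ * Y) = X * ((L μ)ᴴ * L μ * ρ) * Y := by
      calc (L μ)ᴴ * L μ * (X * ρ * Y) = (L μ)ᴴ * (L μ * X) * ρ * Y := by noncomm_ring
        _ = ((L μ)ᴴ * X) * L μ * ρ * Y := by rw [hLX]; noncomm_ring
        _ = _ := by rw [hLX']; noncomm_ring
    have h3 : X * ρ * Y * ((L μ)ᴴ * L μ) = X * (ρ * ((L μ)ᴴ * L μ)) * Y := by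
      calc X * ρ * Y * ((L μ)ᴴ * L μ) = X * ρ * (Y * (L μ)ᴴ) * L μ := by noncomm_ring
        _ = X * ρ * (L μ)ᴴ * (Y * L μ) := by rw [← hLY']; noncomm_ring
        _ = _ := by rw [← hLY]; noncomm_ring
    rw [h1, h2, h3, mul_sub, sub_mul, mul_add, add_mul, Matrix.mul_smul, Matrix.smul_mul]
  rw [liouvillian_apply, liouvillian_apply, hham, Finset.sum_congr rfl fun μ _ => hdis μ]
  rw [mul_add X, add_mul _ _ Y, Finset.mul_sum, Finset.sum_mul, smul_add, smul_smul,
    Matrix.mul_smul, Matrix.smul_mul, neg_mul, neg_smul (Complex.I * _)]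
  abel

theorem liouvillian_pow_mul_pow {ρ : Matrix d d ℂ} (hH : H.IsHermitian)
    (hA : IsStrongDynamicalSymmetry H L ω A) (hρ : liouvillian H L ρ = 0) (n m : ℕ) :
    liouvillian H L (A ^ n * ρ * Aᴴ ^ m) =
      (-Complex.I * ω * ((n : ℂ) - m)) • (A ^ n * ρ * Aᴴ ^ m) := by
  rw [(hA.pow n).liouvillian_mul_mul ((hA.conjTranspose hH).pow m), hρ, Matrix.mul_zero,
    Matrix.zero_mul, zero_sub, ← neg_smul]
  congr 1
  push_cast
  ring

theorem adjointLiouvillian_pow_mul_pow (hH : H.IsHermitian)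
    (hA : IsStrongDynamicalSymmetry H L (-ω) A) (n m : ℕ) :
    adjointLiouvillian H L (A ^ m * 1 * Aᴴ ^ n) =
      (Complex.I * ω * ((n : ℂ) - m)) • (A ^ m * 1 * Aᴴ ^ n) := by
  rw [Matrix.mul_one, ((hA.pow m).mul ((hA.conjTranspose hH).pow n)).adjointLiouvillian_eq]
  congr 1
  push_cast
  ring

end IsStrongDynamicalSymmetry

/-! ### Imaginary eigenspaces: classification, duality and dimension. -/

section Faithful

variable {ρ₀ : Matrix d d ℂ}

/-- Given a faithful steady state, the eigenvectors of the Heisenberg generator with imaginary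
eigenvalue are exactly the strong dynamical symmetries. -/
theorem adjointLiouvillian_eq_iff (hH : H.IsHermitian) (hρ : IsSteadyState H L ρ₀)
    (hu : IsUnit ρ₀) {l : ℝ} {X : Matrix d d ℂ} :
    adjointLiouvillian H L X = (Complex.I * l) • X ↔ IsStrongDynamicalSymmetry H L l X := by
  refine ⟨fun hX => ?_, fun hX => hX.adjointLiouvillian_eq⟩
  have hj := jump_commute_of_adjointLiouvillian_eq hH hρ hu hX
  -- `X†` is again an eigenvector with imaginary eigenvalue, so it commutes with the jumps; taking
  -- adjoints gives the commutation of `X` with `L_μ†`.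
  have hX' : adjointLiouvillian H L Xᴴ = (Complex.I * (-l : ℝ)) • Xᴴ := by
    rw [adjointLiouvillian_conjTranspose hH, hX, conjTranspose_smul]
    simp
  have hja : ∀ μ, (L μ)ᴴ * X - X * (L μ)ᴴ = 0 := by
    intro μ
    have h := congrArg Matrix.conjTranspose (jump_commute_of_adjointLiouvillian_eq hH hρ hu hX' μ)
    simp only [conjTranspose_sub, conjTranspose_mul, conjTranspose_conjTranspose,
      conjTranspose_zero] at h
    rw [← neg_sub, h, neg_zero]
  refine ⟨?_, hj, hja⟩
  have h1 : ∀ μ, (2 : ℂ) • ((L μ)ᴴ * X * L μ) -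
      ((L μ)ᴴ * L μ * X + X * ((L μ)ᴴ * L μ)) = 0 := by
    intro μ
    rw [Matrix.mul_assoc (L μ)ᴴ (L μ) X, sub_eq_zero.mp (hj μ), ← Matrix.mul_assoc X,
      ← sub_eq_zero.mp (hja μ), ← Matrix.mul_assoc, two_smul, sub_self]
  rw [adjointLiouvillian_apply, Finset.sum_eq_zero fun μ _ => h1 μ, add_zero, mul_smul] at hX
  exact smul_right_injective _ Complex.I_ne_zero hX

/-- The linear map `X ↦ (Y ↦ Tr (X Y))`. -/
noncomputable def tracePairing (d : Type*) [Fintype d] [DecidableEq d] :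
    Matrix d d ℂ →ₗ[ℂ] Module.Dual ℂ (Matrix d d ℂ) :=
  (LinearMap.mul ℂ (Matrix d d ℂ)).compr₂ (Matrix.traceLinearMap d ℂ ℂ)

theorem tracePairing_bijective : Function.Bijective (tracePairing d) := by
  have hi : Function.Injective (tracePairing d) := fun X Y h =>
    ext_iff_trace_mul_right.mpr fun Z => LinearMap.congr_fun h Z
  exact ⟨hi, (LinearMap.injective_iff_surjective_of_finrank_eq_finrank
    Subspace.dual_finrank_eq.symm).mp hi⟩

/-- Under the bilinear trace pairing `𝓛† - c` is the transpose of `𝓛 - c`, and a map and its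
transpose have equal rank. Bilinearity is why `c` appears unconjugated on both sides. -/
theorem finrank_eigenspace_liouvillian (hH : H.IsHermitian) (c : ℂ) :
    Module.finrank ℂ ((liouvillian H L).eigenspace c) =
      Module.finrank ℂ ((adjointLiouvillian H L).eigenspace c) := by
  let e := LinearEquiv.ofBijective (tracePairing d) tracePairing_bijective
  let f := liouvillian H L - algebraMap ℂ (Module.End ℂ (Matrix d d ℂ)) c
  let g := adjointLiouvillian H L - algebraMap ℂ (Module.End ℂ (Matrix d d ℂ)) c
  have hcomm : f.dualMap ∘ₗ e.toLinearMap = e.toLinearMap ∘ₗ g := by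
    refine LinearMap.ext fun X => LinearMap.ext fun Y => ?_
    change (X * (liouvillian H L Y - c • Y)).trace = ((adjointLiouvillian H L X - c • X) * Y).trace
    rw [mul_sub, sub_mul, trace_sub, trace_sub, trace_adjointLiouvillian_mul hH, Matrix.mul_smul,
      Matrix.smul_mul]
  have hr : Module.finrank ℂ (LinearMap.range f) = Module.finrank ℂ (LinearMap.range g) := by
    rw [← LinearMap.finrank_range_dualMap_eq_finrank_range,
      ← LinearMap.range_comp_of_range_eq_top f.dualMap e.range, hcomm, LinearMap.range_comp]
    exact LinearEquiv.finrank_map_eq e _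
  have hf := LinearMap.finrank_range_add_finrank_ker f
  have hg := LinearMap.finrank_range_add_finrank_ker g
  rw [Module.End.eigenspace_def, Module.End.eigenspace_def]
  change Module.finrank ℂ (LinearMap.ker f) = Module.finrank ℂ (LinearMap.ker g)
  omega

theorem mem_eigenspace_adjointLiouvillian_iff (hH : H.IsHermitian) (hρ : IsSteadyState H L ρ₀)
    (hu : IsUnit ρ₀) {l : ℝ} {X : Matrix d d ℂ} :
    X ∈ (adjointLiouvillian H L).eigenspace (Complex.I * l) ↔
      IsStrongDynamicalSymmetry H L l X := by
  rw [Module.End.mem_eigenspace_iff, adjointLiouvillian_eq_iff hH hρ hu]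

theorem IsStrongDynamicalSymmetry.mul_mem_eigenspace (hρ : IsSteadyState H L ρ₀) {l : ℝ}
    {A : Matrix d d ℂ} (hA : IsStrongDynamicalSymmetry H L (-l) A) :
    A * ρ₀ ∈ (liouvillian H L).eigenspace (Complex.I * l) := by
  rw [Module.End.mem_eigenspace_iff]
  -- The identity serves as the right factor, a symmetry of frequency zero.
  have h := hA.liouvillian_mul_mul one ρ₀
  rw [hρ.stationary, Matrix.mul_zero, Matrix.zero_mul, Matrix.mul_one] at h
  rw [h, zero_sub, ← neg_smul]
  congr 1
  push_cast
  ring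

/-- Right multiplication by a steady state, from the strong dynamical symmetries of frequency `-l`
to the eigenspace of the Liouvillian for `i l`. -/
noncomputable def mulSteadyState (hH : H.IsHermitian) (hρ : IsSteadyState H L ρ₀)
    (hu : IsUnit ρ₀) (l : ℝ) :
    (adjointLiouvillian H L).eigenspace (Complex.I * (-l : ℝ)) →ₗ[ℂ]
      (liouvillian H L).eigenspace (Complex.I * l) :=
  (LinearMap.mulRight ℂ ρ₀).restrict fun _ hA =>
    ((mem_eigenspace_adjointLiouvillian_iff hH hρ hu).mp hA).mul_mem_eigenspace hρ

theorem mulSteadyState_injective (hH : H.IsHermitian) (hρ : IsSteadyState H L ρ₀)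
    (hu : IsUnit ρ₀) (l : ℝ) : Function.Injective (mulSteadyState hH hρ hu l) := fun _ _ h =>
  Subtype.ext (hu.mul_right_cancel (congrArg Subtype.val h))

/-- The embedding by `ρ₀` at `l` gives one inequality; the one at `-l`, with left and right
dimensions exchanged by duality, gives the reverse. -/
theorem finrank_eigenspace_neg (hH : H.IsHermitian) (hρ : IsSteadyState H L ρ₀)
    (hu : IsUnit ρ₀) (l : ℝ) :
    Module.finrank ℂ ((adjointLiouvillian H L).eigenspace (Complex.I * (-l : ℝ))) =
      Module.finrank ℂ ((liouvillian H L).eigenspace (Complex.I * l)) := by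
  refine le_antisymm
    (LinearMap.finrank_le_finrank_of_injective (mulSteadyState_injective hH hρ hu l)) ?_
  have h := LinearMap.finrank_le_finrank_of_injective (mulSteadyState_injective hH hρ hu (-l))
  rwa [neg_neg, finrank_eigenspace_liouvillian hH, ← finrank_eigenspace_liouvillian hH] at h

theorem exists_eq_mul_steadyState (hH : H.IsHermitian) (hρ : IsSteadyState H L ρ₀)
    (hu : IsUnit ρ₀) {l : ℝ} {ρ : Matrix d d ℂ}
    (h : ρ ∈ (liouvillian H L).eigenspace (Complex.I * l)) :
    ∃ A, IsStrongDynamicalSymmetry H L (-l) A ∧ ρ = A * ρ₀ := by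
  obtain ⟨A, hA⟩ := (LinearMap.injective_iff_surjective_of_finrank_eq_finrank
    (finrank_eigenspace_neg hH hρ hu l)).mp (mulSteadyState_injective hH hρ hu l) ⟨ρ, h⟩
  exact ⟨A, (mem_eigenspace_adjointLiouvillian_iff hH hρ hu).mp A.2,
    (congrArg Subtype.val hA).symm⟩

/-- The trace pairing between the left and right eigenspaces for an imaginary eigenvalue is
perfect. -/
theorem exists_trace_mul_eq (hH : H.IsHermitian) (hρ : IsSteadyState H L ρ₀)
    (hu : IsUnit ρ₀) {l : ℝ}
    (φ : Module.Dual ℂ ((liouvillian H L).eigenspace (Complex.I * l))) :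
    ∃ Y, IsStrongDynamicalSymmetry H L l Y ∧
      ∀ r : (liouvillian H L).eigenspace (Complex.I * l), (Y * (r : Matrix d d ℂ)).trace = φ r := by
  let P : (adjointLiouvillian H L).eigenspace (Complex.I * l) →ₗ[ℂ]
      Module.Dual ℂ ((liouvillian H L).eigenspace (Complex.I * l)) :=
    (Submodule.subtype _).dualMap ∘ₗ tracePairing d ∘ₗ Submodule.subtype _
  have hP : Function.Injective P := by
    rw [injective_iff_map_eq_zero]
    intro Y hY
    have hYs := (mem_eigenspace_adjointLiouvillian_iff hH hρ hu).mp Y.2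
    -- The test vector `Y† ρ₀` lies in the right eigenspace, and pairing `Y` with it gives a
    -- faithful quadratic form in `Y†`.
    have h0 : ((Y : Matrix d d ℂ) * ((Y : Matrix d d ℂ)ᴴ * ρ₀)).trace = 0 :=
      LinearMap.congr_fun hY ⟨_, (hYs.conjTranspose hH).mul_mem_eigenspace hρ⟩
    have h1 : (Y : Matrix d d ℂ)ᴴ = 0 := by
      refine eq_zero_of_trace_conjTranspose_mul_self_mul hρ.posSemidef hu ?_
      rwa [conjTranspose_conjTranspose, Matrix.mul_assoc]
    exact Subtype.ext (conjTranspose_eq_zero.mp h1)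
  have hd : Module.finrank ℂ ((adjointLiouvillian H L).eigenspace (Complex.I * l)) =
      Module.finrank ℂ (Module.Dual ℂ ((liouvillian H L).eigenspace (Complex.I * l))) := by
    rw [Subspace.dual_finrank_eq, finrank_eigenspace_liouvillian hH]
  obtain ⟨Y, hY⟩ := (LinearMap.injective_iff_surjective_of_finrank_eq_finrank hd).mp hP φ
  exact ⟨Y, (mem_eigenspace_adjointLiouvillian_iff hH hρ hu).mp Y.2,
    fun r => LinearMap.congr_fun hY r⟩

end Faithful

/-- If the product vanished, multiplying by the missing powers of `A†` on the left or of `A` on the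
right would give `(A^k)† A^k = 0` with `k = max n m`, hence `A^k = 0`. -/
theorem conjTranspose_pow_mul_pow_ne_zero {A : Matrix d d ℂ} {n m : ℕ} (hn : A ^ n ≠ 0)
    (hm : A ^ m ≠ 0) : Aᴴ ^ m * A ^ n ≠ 0 := by
  intro h
  rcases le_total m n with hmn | hmn
  · refine hn (conjTranspose_mul_self_eq_zero.mp ?_)
    rw [conjTranspose_pow, ← Nat.sub_add_cancel hmn, pow_add Aᴴ, Nat.sub_add_cancel hmn,
      Matrix.mul_assoc, h, Matrix.mul_zero]
  · refine hm (conjTranspose_mul_self_eq_zero.mp ?_)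
    rw [conjTranspose_pow, ← Nat.add_sub_cancel' hmn, pow_add A, Nat.add_sub_cancel' hmn,
      ← Matrix.mul_assoc, h, Matrix.zero_mul]

end Lindblad

/-! ### Assembly of the main theorem. -/

theorem theorem2 {d ι : Type*} [Fintype d] [DecidableEq d] [Fintype ι]
    (H : Matrix d d ℂ) (hH : H.IsHermitian) (L : ι → Matrix d d ℂ)
    (hfaithful : ∃ ρ₀ : Matrix d d ℂ, Lindblad.IsSteadyState H L ρ₀ ∧ IsUnit ρ₀) :
    -- right eigenvectors with purely imaginary eigenvalue are exactly the nonzero `A^n ρ∞ (A†)^m`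
    (∀ ρ : Matrix d d ℂ,
      (∃ l : ℝ, (Lindblad.liouvillian H L).HasEigenvector (Complex.I * l) ρ) ↔
        ρ ≠ 0 ∧ ∃ (ω : ℝ) (A ρinf : Matrix d d ℂ) (n m : ℕ),
          Lindblad.IsStrongDynamicalSymmetry H L ω A ∧ Lindblad.IsSteadyState H L ρinf ∧
          ρ = A ^ n * ρinf * Aᴴ ^ m) ∧
    -- the eigenvalue is `-i ω (n - m)`
    (∀ (ω : ℝ) (A ρinf : Matrix d d ℂ) (n m : ℕ),
      Lindblad.IsStrongDynamicalSymmetry H L ω A → Lindblad.IsSteadyState H L ρinf →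
      A ^ n * ρinf * Aᴴ ^ m ≠ 0 →
      (Lindblad.liouvillian H L).HasEigenvector (-Complex.I * ω * ((n : ℂ) - (m : ℂ)))
        (A ^ n * ρinf * Aᴴ ^ m)) ∧
    -- left eigenvectors with purely imaginary eigenvalue are exactly the nonzero `A'^m 1 (A'†)^n`
    (∀ σ : Matrix d d ℂ,
      (∃ l : ℝ, (Lindblad.adjointLiouvillian H L).HasEigenvector (Complex.I * l) σ) ↔
        σ ≠ 0 ∧ ∃ (ω : ℝ) (A' : Matrix d d ℂ) (n m : ℕ),
          Lindblad.IsStrongDynamicalSymmetry H L (-ω) A' ∧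
          σ = A' ^ m * 1 * A'ᴴ ^ n) ∧
    -- with `𝓛† σ = i ω (n - m) σ`
    (∀ (ω : ℝ) (A' : Matrix d d ℂ) (n m : ℕ),
      Lindblad.IsStrongDynamicalSymmetry H L (-ω) A' →
      A' ^ m * 1 * A'ᴴ ^ n ≠ 0 →
      (Lindblad.adjointLiouvillian H L).HasEigenvector (Complex.I * ω * ((n : ℂ) - (m : ℂ)))
        (A' ^ m * 1 * A'ᴴ ^ n)) ∧
    -- every `A^n ρ∞ (A†)^m` has, with the same `n`, `m`, `ω`, a left eigenvector for the
    -- conjugate eigenvalue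
    (∀ (ω : ℝ) (A ρinf : Matrix d d ℂ) (n m : ℕ),
      Lindblad.IsStrongDynamicalSymmetry H L ω A → Lindblad.IsSteadyState H L ρinf →
      A ^ n * ρinf * Aᴴ ^ m ≠ 0 →
      ∃ A' : Matrix d d ℂ, Lindblad.IsStrongDynamicalSymmetry H L (-ω) A' ∧
        (Lindblad.adjointLiouvillian H L).HasEigenvector (Complex.I * ω * ((n : ℂ) - (m : ℂ)))
          (A' ^ m * 1 * A'ᴴ ^ n)) ∧
    -- every basis of a purely imaginary eigenspace has a biorthonormal family of left eigenvectors,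
    -- and both are of the stated form with common `ω`, `n`, `m`
    (∀ (l : ℝ) (k : ℕ)
      (r : Module.Basis (Fin k) ℂ ((Lindblad.liouvillian H L).eigenspace (Complex.I * l))),
      ∃ (s : Fin k → Matrix d d ℂ) (ω : ℝ) (n m : ℕ),
        Complex.I * l = -Complex.I * ω * ((n : ℂ) - (m : ℂ)) ∧
        (∀ i j, Lindblad.hsInner (s i) (r j : Matrix d d ℂ) = if i = j then 1 else 0) ∧
        ∀ i,
          (∃ A ρinf : Matrix d d ℂ,
            Lindblad.IsStrongDynamicalSymmetry H L ω A ∧ Lindblad.IsSteadyState H L ρinf ∧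
            (r i : Matrix d d ℂ) = A ^ n * ρinf * Aᴴ ^ m) ∧
          ∃ A' : Matrix d d ℂ, Lindblad.IsStrongDynamicalSymmetry H L (-ω) A' ∧
            (Lindblad.adjointLiouvillian H L).HasEigenvector
              (Complex.I * ω * ((n : ℂ) - (m : ℂ))) (s i) ∧
            s i = A' ^ m * 1 * A'ᴴ ^ n) := by
  obtain ⟨ρ₀, hρ, hu⟩ := hfaithful
  refine ⟨fun ρ => ⟨fun ⟨l, hl⟩ => ?_, ?_⟩, fun ω A ρinf n m hA hinf h0 => ?_,
    fun σ => ⟨fun ⟨l, hl⟩ => ?_, ?_⟩, fun ω A' n m hA h0 => ?_, fun ω A ρinf n m hA hinf h0 => ?_,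
    fun l k r => ?_⟩
  · obtain ⟨A, hA, rfl⟩ := Lindblad.exists_eq_mul_steadyState hH hρ hu hl.1
    exact ⟨hl.2, -l, A, ρ₀, 1, 0, hA, hρ, by simp⟩
  · rintro ⟨h0, ω, A, ρinf, n, m, hA, hinf, rfl⟩
    refine ⟨-ω * (n - m), Module.End.mem_eigenspace_iff.mpr ?_, h0⟩
    rw [hA.liouvillian_pow_mul_pow hH hinf.stationary]
    congr 1
    push_cast
    ring
  · exact ⟨Module.End.mem_eigenspace_iff.mpr
      (hA.liouvillian_pow_mul_pow hH hinf.stationary n m), h0⟩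
  -- `σ` is itself a symmetry of frequency `l`, so `A' = σ` with `n = 0`, `m = 1` and `ω = -l`.
  · refine ⟨hl.2, -l, σ, 0, 1, ?_, by simp⟩
    rw [neg_neg]
    exact (Lindblad.mem_eigenspace_adjointLiouvillian_iff hH hρ hu).mp hl.1
  · rintro ⟨h0, ω, A', n, m, hA, rfl⟩
    refine ⟨ω * (n - m), Module.End.mem_eigenspace_iff.mpr ?_, h0⟩
    rw [hA.adjointLiouvillian_pow_mul_pow hH]
    congr 1
    push_cast
    ring
  · exact ⟨Module.End.mem_eigenspace_iff.mpr (hA.adjointLiouvillian_pow_mul_pow hH n m), h0⟩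
  · have hn : A ^ n ≠ 0 := fun h => h0 (by rw [h, Matrix.zero_mul, Matrix.zero_mul])
    have hm : A ^ m ≠ 0 := fun h => h0 (by
      rw [← Matrix.conjTranspose_pow, h, Matrix.conjTranspose_zero, Matrix.mul_zero])
    -- The choice `A' = A†` turns the left eigenvector into `(A†)^m A^n`.
    refine ⟨Aᴴ, hA.conjTranspose hH, Module.End.mem_eigenspace_iff.mpr
      ((hA.conjTranspose hH).adjointLiouvillian_pow_mul_pow hH n m), ?_⟩
    rw [Matrix.mul_one, Matrix.conjTranspose_conjTranspose]
    exact Lindblad.conjTranspose_pow_mul_pow_ne_zero hn hm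
  -- `Y i` represents the `i`-th coordinate functional; the dual vector is `(Y i)†` because the
  -- Hilbert-Schmidt product conjugates its first argument.
  · choose Y hY hYr using fun i => Lindblad.exists_trace_mul_eq hH hρ hu (r.coord i)
    have hdual : ∀ i j, Lindblad.hsInner (Y i)ᴴ (r j : Matrix d d ℂ) = if i = j then 1 else 0 := by
      intro i j
      rw [Lindblad.hsInner, Matrix.conjTranspose_conjTranspose, hYr, Module.Basis.coord_apply,
        Module.Basis.repr_self, Finsupp.single_apply]
      simp only [eq_comm]
    -- With `n = 1`, `m = 0` and `ω = -l`, the left form is just `A'†` for `A' = Y i`, and the same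
    -- exponents fit every `r i = A ρ₀`.
    refine ⟨fun i => (Y i)ᴴ, -l, 1, 0, by simp, hdual, fun i => ⟨?_, Y i, ?_, ⟨?_, ?_⟩, by simp⟩⟩
    · obtain ⟨A, hA, hAr⟩ := Lindblad.exists_eq_mul_steadyState hH hρ hu (r i).2
      exact ⟨A, ρ₀, hA, hρ, by simpa using hAr⟩
    · rw [neg_neg]
      exact hY i
    · rw [Module.End.mem_eigenspace_iff, ((hY i).conjTranspose hH).adjointLiouvillian_eq]
      simp
    · intro h
      have := hdual i i
      simp [Lindblad.hsInner, Matrix.conjTranspose_eq_zero.mp h] at this
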